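/- **Setting.** Let $V$ be a finite vertex set and let $X$ be a family of directed graphs on $V$ (an instance $G\in X$ may carry further data such as capacities), each having at least one edge. Write $E(G)\subseteq V\times V$ for the edge set of $G$ and $E=\bigcup_{G\in X}E(G)$ for the set of all edges that occur in the family. Let $\phi(G,e)=(M_1(G,e),\dots,M_d(G,e))\in\mathbb R^d$ be a vector of $d$ real-valued edge metrics ($X$ is a measurable space, the sets $\{G: e\in E(G)\}$ and the functions $M_i(\cdot,e)$, $e\in E$, are measurable). For $w\in\mathbb R^d$ let $$h_w(G)=\operatorname*{arg\,max}_{e\in E(G)} w\cdot\phi(G,e),$$ ties being broken by a fixed linear order on the edges, and let $H=\{h_w : w\in\mathbb R^d\}$. **Theorem.** Edge selection is (properly) PAC learnable in the realizable case, with the following sample complexity. There is a universal constant $C$ such that, for every $d$, every such $V$, $X$, $\phi$ and tie-breaking order, there are a learning algorithm $A$, which maps every finite labelled sample to a member of $H$, and a function $m_H:(0,1)^2\to\mathbb N$ with $$m_H(\epsilon,\delta)\le C\cdot\frac{|E|\,d\,\log^2\!\big(\tfrac{|E|d}{\epsilon}\big)+\log\tfrac1\delta}{\epsilon}$$ (the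 first term of the numerator being $0$ if $|E|d=0$), such that for all $\epsilon,\delta\in(0,1)$, every probability distribution $D$ on $X$, every labelling $f:X\to V\times V$ that agrees $D$-almost surely with some member of $H$, and every $m\ge m_H(\epsilon,\delta)$: if $G_1,\dots,G_m$ are drawn independently from $D$ and $\hat h=A\big((G_1,f(G_1)),\dots,(G_m,f(G_m))\big)$, then with probability at least $1-\delta$ $$D\{G:\hat h(G)\ne f(G)\}\le\epsilon .$$ Moreover, for each fixed number $d$ of metrics, $A$ runs in polynomial time: there is a polynomial $p_d$, depending only on $d$, such that on $m_H(\epsilon,\delta)$ examples $A$ computes its weight vector $w$ with at most $p_d(|E|,1/\epsilon,1/\delta)$ steps of an algebraic computation tree (reads, exact real arithmetic operations and sign tests) whose inputs are, for each example and each $e\in E$, the indicator of $e\in E(G_i)$, the indicator of $e$ being the label, and the $d$ numbers $M_j(G_i,e)$. -/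

import Mathlib

open MeasureTheory

universe u v

noncomputable section

namespace EdgePAC

/-! ### Realizable PAC learning of a multiclass hypothesis class -/

/-- The error of a hypothesis `h` with respect to the distribution `D` and the labelling `f`. -/
def trueError {X : Type v} {Y : Type u} [MeasurableSpace X] (D : Measure X) (f h : X → Y) :
    ENNReal :=
  D {x | h x ≠ f x}

/-- The instances `x 0, …, x (m - 1)` together with their labels under `f`. -/
def labelled {X : Type v} {Y : Type u} (f : X → Y) {m : ℕ} (x : Fin m → X) : Fin m → X × Y :=
  fun i => (x i, f (x i))

/-- `A` is a proper PAC learner (realizable case) for the class `H` with sample size `mH`: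
it always returns a member of `H`, and for all `ε, δ ∈ (0,1)`, all distributions `D` on the
instances and all labellings `f` that agree `D`-almost surely with some member of `H` (so that the
best possible error is `0`), if `A` is run on `m ≥ mH ε δ` i.i.d. examples, then the probability
that the error of its output exceeds `ε` is at most `δ`.  (The measure of a set that is not
measurable is its outer measure in Mathlib, so no measurability of `A` is presupposed.) -/
def IsPACLearner {X : Type v} {Y : Type u} [MeasurableSpace X] (H : Set (X → Y))
    (A : ∀ m : ℕ, (Fin m → X × Y) → (X → Y)) (mH : ℝ → ℝ → ℕ) : Prop :=
  (∀ m S, A m S ∈ H) ∧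
  ∀ ε ∈ Set.Ioo (0 : ℝ) 1, ∀ δ ∈ Set.Ioo (0 : ℝ) 1,
    ∀ (D : Measure X) [IsProbabilityMeasure D] (f : X → Y),
      (∃ h ∈ H, ∀ᵐ x ∂D, h x = f x) →
      ∀ m : ℕ, mH ε δ ≤ m →
        Measure.pi (fun _ : Fin m => D)
          {x | ENNReal.ofReal ε < trueError D f (A m (labelled f x))} ≤ ENNReal.ofReal δ

/-! ### Exact real arithmetic with a step count

Algebraic computation trees: sign tests of arithmetic expressions in the real inputs.  Values are
never stored, so an expression is paid for every time it is evaluated. -/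

/-- Arithmetic expressions in real inputs indexed by `ι`, with rational constants. -/
inductive Expr (ι : Type u) : Type u
  | input (i : ι) : Expr ι
  | const (q : ℚ) : Expr ι
  | add (a b : Expr ι) : Expr ι
  | sub (a b : Expr ι) : Expr ι
  | mul (a b : Expr ι) : Expr ι
  | div (a b : Expr ι) : Expr ι

/-- The value of an expression (division by zero returns zero). -/
def Expr.eval {ι : Type u} (x : ι → ℝ) : Expr ι → ℝ
  | .input i => x i
  | .const q => (q : ℝ)
  | .add a b => a.eval x + b.eval x
  | .sub a b => a.eval x - b.eval x
  | .mul a b => a.eval x * b.eval x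
  | .div a b => a.eval x / b.eval x

/-- The number of steps (reads and arithmetic operations) that evaluating an expression takes. -/
def Expr.steps {ι : Type u} : Expr ι → ℕ
  | .input _ => 1
  | .const _ => 1
  | .add a b => a.steps + b.steps + 1
  | .sub a b => a.steps + b.steps + 1
  | .mul a b => a.steps + b.steps + 1
  | .div a b => a.steps + b.steps + 1

/-- Algebraic computation trees with real inputs indexed by `ι` and `d` real outputs. -/
inductive CompTree (ι : Type u) (d : ℕ) : Type u
  | output (w : Fin d → Expr ι) : CompTree ι d
  | ifPos (t : Expr ι) (yes no : CompTree ι d) : CompTree ι d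

/-- The output of a tree on the input `x`. -/
def CompTree.run {ι : Type u} {d : ℕ} (x : ι → ℝ) : CompTree ι d → (Fin d → ℝ)
  | .output w => fun i => (w i).eval x
  | .ifPos t yes no => if 0 < t.eval x then yes.run x else no.run x

/-- The number of steps that a tree takes on the input `x`. -/
def CompTree.steps {ι : Type u} {d : ℕ} (x : ι → ℝ) : CompTree ι d → ℕ
  | .output w => 1 + ∑ i, (w i).steps
  | .ifPos t yes no => t.steps + 1 + if 0 < t.eval x then yes.steps x else no.steps x

/-! ### Edge selection from a family of directed graphs -/

/-- A family of directed graphs on the vertex set `V`, indexed by the instance space `X`, with a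
`d`-dimensional vector of edge metrics.  For a bare set `𝒢` of digraphs take `X = 𝒢`; a general `X`
allows instances that carry further data (capacities, source, sink) on which the metrics depend. -/
structure GraphFamily (V : Type u) (X : Type v) [MeasurableSpace X] (d : ℕ) where
  /-- the directed graph of an instance -/
  graph : X → Digraph V
  /-- every graph has an edge to select -/
  exists_edge : ∀ x, ∃ e : V × V, (graph x).Adj e.1 e.2
  /-- the vector of the metrics `M₁(G,e), …, M_d(G,e)` -/
  φ : X → V × V → Fin d → ℝ
  /-- the fixed order on the edges by which ties of the argmax are broken -/
  rank : V × V ↪ ℕ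
  measurableSet_adj : ∀ e : V × V, MeasurableSet {x | (graph x).Adj e.1 e.2}
  measurable_φ : ∀ e : V × V, (∃ x, (graph x).Adj e.1 e.2) → ∀ i, Measurable fun x => φ x e i

namespace GraphFamily

variable {V : Type u} {X : Type v} [MeasurableSpace X] {d : ℕ}

/-- The edge set `E(G)` of an instance. -/
def E (F : GraphFamily V X d) (x : X) : Set (V × V) :=
  {e | (F.graph x).Adj e.1 e.2}

/-- The set `E_max` of all edges that occur in some graph of the family. -/
def Emax (F : GraphFamily V X d) : Set (V × V) :=
  ⋃ x, F.E x

/-- The set of the maximizers of `w · φ(G,e)` over `e ∈ E(G)`. -/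
def maximizers (F : GraphFamily V X d) (w : Fin d → ℝ) (x : X) : Set (V × V) :=
  {e | e ∈ F.E x ∧ ∀ e' ∈ F.E x, w ⬝ᵥ F.φ x e' ≤ w ⬝ᵥ F.φ x e}

theorem maximizers_nonempty [Finite V] (F : GraphFamily V X d) (w : Fin d → ℝ) (x : X) :
    (F.maximizers w x).Nonempty := by
  obtain ⟨e, he, hmax⟩ := Set.exists_max_image (F.E x) (fun e => w ⬝ᵥ F.φ x e)
    (Set.toFinite _) (F.exists_edge x)
  exact ⟨e, he, hmax⟩

/-- The hypothesis `h_w : G ↦ argmax_{e ∈ E(G)} w · φ(G,e)`; among several maximizers the one of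
least rank is taken. -/
def h [Finite V] (F : GraphFamily V X d) (w : Fin d → ℝ) (x : X) : V × V :=
  Function.argminOn F.rank (F.maximizers w x) (F.maximizers_nonempty w x)

/-- The hypothesis class `{h_w | w ∈ ℝ^d}`. -/
def hypothesisClass [Finite V] (F : GraphFamily V X d) : Set (X → V × V) :=
  Set.range F.h

/-- The real numbers that describe `m` labelled examples: for each example and each potential
edge, whether the edge is present, whether it is the label, and its `d` metrics. -/
inductive InputIndex (F : GraphFamily V X d) (m : ℕ) : Type u
  | isEdge (i : Fin m) (e : F.Emax) : InputIndex F m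
  | isLabel (i : Fin m) (e : F.Emax) : InputIndex F m
  | metric (i : Fin m) (e : F.Emax) (j : Fin d) : InputIndex F m

open Classical in
/-- The description of a labelled sample by real numbers. -/
def encode (F : GraphFamily V X d) {m : ℕ} (S : Fin m → X × (V × V)) : F.InputIndex m → ℝ
  | .isEdge i e => if (e : V × V) ∈ F.E (S i).1 then 1 else 0
  | .isLabel i e => if (e : V × V) = (S i).2 then 1 else 0
  | .metric i e j => F.φ (S i).1 e j

/-- The learner that computes its weight vector by the tree `T m` on samples of size `m`. -/
def learner [Finite V] (F : GraphFamily V X d) (T : ∀ m : ℕ, CompTree (F.InputIndex m) d)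
    (m : ℕ) (S : Fin m → X × (V × V)) : X → V × V :=
  F.h ((T m).run (F.encode S))

end GraphFamily

end EdgePAC

end

/-! By `h_eq_iff`, agreement of `h_w` with a label `e` is a list of linear inequalities in `w`: `w ·
(φ(e) - φ(e')) ≥ 0` for every edge `e'` of the instance, strict if `e'` has smaller rank. The system
is homogeneous, so scaling turns the strict inequalities into inequalities with margin `1`. A
realizable sample thus yields a feasible system of weak inequalities, and such a system has a basic
solution (`exists_basic_solution`): a feasible point determined by `d` tight rows, each a comparison
of two edges in one example or an equation `w j = 0`. Cramer's rule computes it. The learner tries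
all `(m|E|² + d)^d` choices of `d` rows and returns the first weight vector that satisfies every
constraint; for fixed `d` this takes polynomially many steps.

Generalization is a compression argument. Each candidate depends on at most `d` examples, so the
other examples are fresh tests for it, and a candidate of error above `ε` survives them with
probability at most `(1 - ε)^(m - d)` (`pi_holdout_le`). A union bound over the candidates gives
`pi_error_le`, and `candidates_mul_pow_le` checks that the result is at most `δ` from the claimed
sample size on. -/

noncomputable section

namespace EdgePAC

/-! ### Basic solutions of systems of linear inequalities -/

/-- A feasible system of linear inequalities with trivial lineality space has a feasible point
whose tight constraints determine it. -/
theorem exists_feasible_tight_spanning {d : ℕ} {S : Type*} [Finite S] (a : S → Fin d → ℝ)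
    (c : S → ℝ) (hspan : ∀ v : Fin d → ℝ, (∀ s, a s ⬝ᵥ v = 0) → v = 0)
    (w₀ : Fin d → ℝ) (h₀ : ∀ s, c s ≤ a s ⬝ᵥ w₀) :
    ∃ w, (∀ s, c s ≤ a s ⬝ᵥ w) ∧ ∀ v, (∀ s, a s ⬝ᵥ w = c s → a s ⬝ᵥ v = 0) → v = 0 := by
  -- Choose a feasible point with a maximal set of tight constraints; if a direction `v ≠ 0` were
  -- orthogonal to all of them, moving along it would make a further one tight.
  let 𝒯 : Set (Set S) := {T | ∃ w, (∀ s, c s ≤ a s ⬝ᵥ w) ∧ T = {s | a s ⬝ᵥ w = c s}}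
  obtain ⟨T, ⟨w, hw, rfl⟩, hmax⟩ := (Set.toFinite 𝒯).exists_maximal ⟨_, w₀, h₀, rfl⟩
  refine ⟨w, hw, fun v hv => by_contra fun hv0 => ?_⟩
  obtain ⟨v, s, hv, hs⟩ : ∃ (v : Fin d → ℝ) (s : S),
      (∀ s, a s ⬝ᵥ w = c s → a s ⬝ᵥ v = 0) ∧ a s ⬝ᵥ v < 0 := by
    obtain ⟨s, hs⟩ : ∃ s, a s ⬝ᵥ v ≠ 0 := by
      by_contra! h
      exact hv0 (hspan v h)
    rcases lt_or_gt_of_ne hs with h | h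
    · exact ⟨v, s, hv, h⟩
    · exact ⟨-v, s, fun s hs => by simp [dotProduct_neg, hv s hs], by simpa [dotProduct_neg] using h⟩
  -- Ratio test: `s₁` is the first constraint to become tight along `v`, and `t` is the step length
  -- at which it does.
  obtain ⟨s₁, hs₁, hmin⟩ := Set.exists_min_image {s | a s ⬝ᵥ v < 0}
    (fun s => (a s ⬝ᵥ w - c s) / -(a s ⬝ᵥ v)) (Set.toFinite _) ⟨s, hs⟩
  simp only [Set.mem_ofPred_eq] at hs₁ hmin
  set t := (a s₁ ⬝ᵥ w - c s₁) / -(a s₁ ⬝ᵥ v) with ht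
  have ht0 : 0 ≤ t := div_nonneg (sub_nonneg.2 (hw s₁)) (by linarith)
  have hexp : ∀ s, a s ⬝ᵥ (w + t • v) = a s ⬝ᵥ w + t * (a s ⬝ᵥ v) := fun s => by
    rw [dotProduct_add, dotProduct_smul, smul_eq_mul]
  have hfeas : ∀ s, c s ≤ a s ⬝ᵥ (w + t • v) := fun s => by
    rw [hexp]
    rcases lt_or_ge (a s ⬝ᵥ v) 0 with h | h
    · have := (le_div_iff₀ (by linarith : 0 < -(a s ⬝ᵥ v))).1 (hmin s h)
      linarith
    · have := mul_nonneg ht0 h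
      linarith [hw s]
  have htight : a s₁ ⬝ᵥ (w + t • v) = c s₁ := by
    rw [hexp, ht, div_neg, neg_mul, div_mul_cancel₀ _ hs₁.ne]
    ring
  have hsub := hmax ⟨_, hfeas, rfl⟩ (fun s (hs : a s ⬝ᵥ w = c s) => by
    simp only [Set.mem_ofPred_eq]
    rw [hexp, hv s hs, hs, mul_zero, add_zero])
  exact hs₁.ne (hv s₁ (hsub htight))

/-- From a family of vectors that spans `ℝ^d` one can choose the rows of an invertible matrix. -/
theorem exists_rows_det_ne_zero {d : ℕ} {S : Type*} (a : S → Fin d → ℝ) (T : Set S)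
    (hT : ∀ v : Fin d → ℝ, (∀ s ∈ T, a s ⬝ᵥ v = 0) → v = 0) :
    ∃ r : Fin d → S, (∀ k, r k ∈ T) ∧ (Matrix.of fun k => a (r k)).det ≠ 0 := by
  -- A proper span would lie in the kernel of a nonzero functional, and the vector representing it
  -- would contradict `hT`.
  have htop : Submodule.span ℝ (a '' T) = ⊤ := by
    by_contra hne
    obtain ⟨f, hf0, hf⟩ := Submodule.exists_le_ker_of_lt_top _ (lt_top_iff_ne_top.2 hne)
    have hfd : ∀ u : Fin d → ℝ, u ⬝ᵥ (fun j => f (Pi.single j 1)) = f u := fun u => by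
      conv_rhs => rw [pi_eq_sum_univ' u]
      simp [dotProduct, map_sum]
    have h0 := hT _ fun s hs => by
      rw [hfd]
      exact hf (Submodule.subset_span ⟨s, hs, rfl⟩)
    refine hf0 (LinearMap.ext fun u => ?_)
    rw [← hfd, h0]
    simp
  obtain ⟨b, hb, hspan, hli⟩ := exists_linearIndependent ℝ (a '' T)
  have B := Module.Basis.mk hli (by rw [Subtype.range_coe, hspan, htop])
  have : Finite b := Module.Finite.finite_basis B
  have := Fintype.ofFinite b
  have hcard : Fintype.card b = d := by
    rw [← Module.finrank_eq_card_basis B, Module.finrank_fin_fun]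
  let e : Fin d ≃ b := (finCongr hcard.symm).trans (Fintype.equivFin b).symm
  choose g hgT hg using fun k : Fin d => hb (e k).2
  refine ⟨g, hgT, ?_⟩
  have hli' : LinearIndependent ℝ (Matrix.of fun k => a (g k)).row := by
    have : (Matrix.of fun k => a (g k)).row = (fun x : b => (x : Fin d → ℝ)) ∘ e := by
      ext k j
      simp [Matrix.row, hg]
    rw [this]
    exact hli.comp _ e.injective
  have := Matrix.linearIndependent_rows_iff_isUnit.1 hli'
  exact ((Matrix.isUnit_iff_isUnit_det _).1 this).ne_zero

/-- A feasible system of linear inequalities has a feasible point that is the unique solution of a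
square system composed of some of the constraints and of equations `w j = 0`. -/
theorem exists_basic_solution {d : ℕ} {S : Type*} [Finite S] (a : S → Fin d → ℝ)
    (c : S → ℝ) (w₀ : Fin d → ℝ) (h₀ : ∀ s, c s ≤ a s ⬝ᵥ w₀) :
    ∃ (w : Fin d → ℝ) (r : Fin d → S ⊕ Fin d), (∀ s, c s ≤ a s ⬝ᵥ w) ∧
      (Matrix.of fun k => Sum.elim a (fun j => Pi.single j 1) (r k)).det ≠ 0 ∧
      ∀ k, Sum.elim a (fun j => Pi.single j 1) (r k) ⬝ᵥ w = Sum.elim c (fun _ => 0) (r k) := by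
  -- Adding the constraints `σ j * w j ≥ 0` confines `w` to an orthant containing `w₀`. This removes
  -- the lineality space, and tightness of an added constraint means `w j = 0`, whatever the sign;
  -- hence the chosen rows may use unsigned unit vectors.
  let σ : Fin d → ℝ := fun j => if 0 ≤ w₀ j then 1 else -1
  have hσ : ∀ j, σ j ≠ 0 := fun j => by
    simp only [σ]
    split_ifs <;> norm_num
  obtain ⟨w, hw, htight⟩ := exists_feasible_tight_spanning
    (Sum.elim a fun j => Pi.single j (σ j)) (Sum.elim c fun _ => 0)
    (fun v hv => funext fun j => by simpa [hσ] using hv (Sum.inr j)) w₀ (by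
      rintro (s | j)
      · exact h₀ s
      · simp only [Sum.elim_inr, single_dotProduct, σ]
        split_ifs <;> linarith)
  obtain ⟨r, hr, hdet⟩ := exists_rows_det_ne_zero (Sum.elim a fun j => Pi.single j 1)
    {s | Sum.elim a (fun j => Pi.single j 1) s ⬝ᵥ w = Sum.elim c (fun _ => 0) s} (fun v hv => by
      refine htight v ?_
      rintro (s | j) h
      · exact hv (Sum.inl s) h
      · have hj : w j = 0 := by simpa [hσ] using h
        have := hv (Sum.inr j) (by simp [hj])
        simp only [Sum.elim_inr, single_dotProduct, one_mul] at this ⊢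
        simp [this])
  exact ⟨w, r, fun s => hw (Sum.inl s), hdet, hr⟩

/-- A homogeneous system of strict and nonstrict inequalities that is feasible is feasible with
margin `1` in the strict ones. -/
theorem exists_feasible_with_margin {d : ℕ} {S : Type*} [Finite S] (a : S → Fin d → ℝ)
    (P : S → Prop) [DecidablePred P] (w₀ : Fin d → ℝ) (h₀ : ∀ s, 0 ≤ a s ⬝ᵥ w₀)
    (hP : ∀ s, P s → 0 < a s ⬝ᵥ w₀) :
    ∃ w : Fin d → ℝ, ∀ s, (if P s then (1 : ℝ) else 0) ≤ a s ⬝ᵥ w := by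
  obtain ⟨M, hM⟩ := (Set.finite_range fun s => (a s ⬝ᵥ w₀)⁻¹).bddAbove
  -- `M` bounds the inverses of all values. The absolute value keeps the weak inequalities valid
  -- even if `M` is negative.
  refine ⟨|M| • w₀, fun s => ?_⟩
  rw [dotProduct_smul, smul_eq_mul]
  split_ifs with h
  · have h1 : (a s ⬝ᵥ w₀)⁻¹ ≤ |M| := (hM ⟨s, rfl⟩).trans (le_abs_self M)
    calc (1 : ℝ) = (a s ⬝ᵥ w₀)⁻¹ * (a s ⬝ᵥ w₀) := (inv_mul_cancel₀ (hP s h).ne').symm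
      _ ≤ _ := mul_le_mul_of_nonneg_right h1 (h₀ s)
  · exact mul_nonneg (abs_nonneg _) (h₀ s)

/-- Cramer's rule as a formula for the solution of a square system. -/
def cramerSolution {d : ℕ} (A : Matrix (Fin d) (Fin d) ℝ) (b : Fin d → ℝ) : Fin d → ℝ :=
  fun j => (A.updateCol j b).det / A.det

theorem cramerSolution_eq {d : ℕ} {A : Matrix (Fin d) (Fin d) ℝ} {b w : Fin d → ℝ}
    (hA : A.det ≠ 0) (hw : A.mulVec w = b) : cramerSolution A b = w := by
  have hinj : Function.Injective A.mulVec :=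
    Matrix.mulVec_injective_iff_isUnit.2 ((Matrix.isUnit_iff_isUnit_det A).2 (IsUnit.mk0 _ hA))
  apply hinj
  have : cramerSolution A b = (A.det)⁻¹ • A.cramer b := by
    ext j
    simp [cramerSolution, Matrix.cramer_apply, div_eq_inv_mul]
  rw [this, Matrix.mulVec_smul, Matrix.mulVec_cramer, smul_smul, inv_mul_cancel₀ hA, one_smul, hw]

/-! ### Building blocks of computation trees -/

namespace Expr

variable {ι : Type u}

/-- The sum of a list of expressions. -/
def listSum : List (Expr ι) → Expr ι
  | [] => .const 0
  | a :: l => .add a (listSum l)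

/-- The product of a list of expressions. -/
def listProd : List (Expr ι) → Expr ι
  | [] => .const 1
  | a :: l => .mul a (listProd l)

theorem eval_listSum (x : ι → ℝ) (l : List (Expr ι)) :
    (listSum l).eval x = (l.map (eval x)).sum := by
  induction l with
  | nil => simp [listSum, eval]
  | cons a l ih => simp [listSum, eval, ih]

theorem eval_listProd (x : ι → ℝ) (l : List (Expr ι)) :
    (listProd l).eval x = (l.map (eval x)).prod := by
  induction l with
  | nil => simp [listProd, eval]
  | cons a l ih => simp [listProd, eval, ih]

theorem steps_listSum_le {K : ℕ} (l : List (Expr ι)) (h : ∀ a ∈ l, a.steps ≤ K) :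
    (listSum l).steps ≤ l.length * (K + 1) + 1 := by
  induction l with
  | nil => simp [listSum, steps]
  | cons a l ih =>
    have h1 := h a (by simp)
    have h2 := ih fun b hb => h b (by simp [hb])
    simp only [listSum, steps, List.length_cons, add_mul, one_mul]
    omega

theorem steps_listProd_le {K : ℕ} (l : List (Expr ι)) (h : ∀ a ∈ l, a.steps ≤ K) :
    (listProd l).steps ≤ l.length * (K + 1) + 1 := by
  induction l with
  | nil => simp [listProd, steps]
  | cons a l ih =>
    have h1 := h a (by simp)
    have h2 := ih fun b hb => h b (by simp [hb])
    simp only [listProd, steps, List.length_cons, add_mul, one_mul]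
    omega

/-- The determinant, by the Leibniz formula. -/
def det {d : ℕ} (A : Fin d → Fin d → Expr ι) : Expr ι :=
  listSum ((Finset.univ : Finset (Equiv.Perm (Fin d))).toList.map fun σ =>
    .mul (.const ((Equiv.Perm.sign σ : ℤ) : ℚ)) (listProd ((List.finRange d).map fun i => A (σ i) i)))

theorem eval_det {d : ℕ} (x : ι → ℝ) (A : Fin d → Fin d → Expr ι) :
    (det A).eval x = (Matrix.of fun i j => (A i j).eval x).det := by
  rw [det, eval_listSum, List.map_map, Finset.sum_map_toList, Matrix.det_apply']
  refine Finset.sum_congr rfl fun σ _ => ?_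
  simp [eval, eval_listProd, Fin.prod_univ_def, Function.comp_def]

/-- A bound on the steps of a `d × d` determinant with entries of at most `K` steps. -/
def detSteps (d K : ℕ) : ℕ := d.factorial * (d * (K + 1) + 4) + 1

theorem steps_det_le {d K : ℕ} (A : Fin d → Fin d → Expr ι) (hA : ∀ i j, (A i j).steps ≤ K) :
    (det A).steps ≤ detSteps d K := by
  refine (steps_listSum_le (K := d * (K + 1) + 3) _ ?_).trans ?_
  · simp only [List.mem_map, forall_exists_index, and_imp]
    rintro _ σ - rfl
    have := steps_listProd_le (K := K) ((List.finRange d).map fun i => A (σ i) i) (by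
      simp only [List.mem_map, forall_exists_index, and_imp]
      rintro _ i - rfl
      exact hA _ _)
    simp only [List.length_map, List.length_finRange] at this
    simp only [steps]
    omega
  · simp [detSteps, Fintype.card_perm]

/-- Cramer's rule. -/
def cramer {d : ℕ} (A : Fin d → Fin d → Expr ι) (b : Fin d → Expr ι) (j : Fin d) : Expr ι :=
  .div (det fun i k => if k = j then b i else A i k) (det A)

theorem eval_cramer {d : ℕ} (x : ι → ℝ) (A : Fin d → Fin d → Expr ι) (b : Fin d → Expr ι) :
    (fun j => (cramer A b j).eval x) =
      cramerSolution (Matrix.of fun i j => (A i j).eval x) fun i => (b i).eval x := by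
  ext j
  simp only [cramer, eval, eval_det, cramerSolution]
  congr 2
  ext i k
  simp only [Matrix.of_apply, Matrix.updateCol_apply]
  split_ifs <;> rfl

theorem steps_cramer_le {d K : ℕ} (A : Fin d → Fin d → Expr ι) (b : Fin d → Expr ι)
    (hA : ∀ i j, (A i j).steps ≤ K) (hb : ∀ i, (b i).steps ≤ K) (j : Fin d) :
    (cramer A b j).steps ≤ 2 * detSteps d K + 1 := by
  have h1 := steps_det_le A hA
  have h2 := steps_det_le (K := K) (fun i k => if k = j then b i else A i k) (fun i k => by
    split_ifs
    · exact hb i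
    · exact hA i k)
  simp only [cramer, steps]
  omega

end Expr

namespace CompTree

variable {ι : Type u} {d : ℕ}

/-- Proceed with `yes` if none of the expressions `ts` is positive, with `no` otherwise. -/
def ifNonpos (ts : List (Expr ι)) (yes no : CompTree ι d) : CompTree ι d :=
  ts.foldr (fun t T => .ifPos t no T) yes

open Classical in
theorem run_ifNonpos (x : ι → ℝ) (ts : List (Expr ι)) (yes no : CompTree ι d) :
    (ifNonpos ts yes no).run x = if ∀ t ∈ ts, t.eval x ≤ 0 then yes.run x else no.run x := by
  induction ts with
  | nil => simp [ifNonpos]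
  | cons t ts ih =>
    change (ifPos t no (ifNonpos ts yes no)).run x = _
    rw [run, ih]
    by_cases h : 0 < t.eval x
    · simp [h, not_le.2 h]
    · simp [h, not_lt.1 h]

/-- The subtree `no` is copied at every test, but a run enters at most one copy, so its cost is
counted once although the tree itself may be huge. -/
theorem steps_ifNonpos_le {K : ℕ} (x : ι → ℝ) (ts : List (Expr ι)) (yes no : CompTree ι d)
    (h : ∀ t ∈ ts, t.steps ≤ K) :
    (ifNonpos ts yes no).steps x ≤ ts.length * (K + 1) + yes.steps x + no.steps x := by
  induction ts with
  | nil => simp [ifNonpos]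
  | cons t ts ih =>
    have h1 := h t (by simp)
    have h2 := ih fun b hb => h b (by simp [hb])
    change (ifPos t no (ifNonpos ts yes no)).steps x ≤ _
    rw [steps]
    simp only [List.length_cons, add_mul, one_mul]
    split_ifs <;> omega

/-- Output the first candidate `w c` that passes its tests (`0` if there is none). -/
def search {κ : Type*} (w : κ → Fin d → Expr ι) (tests : κ → List (Expr ι)) (cs : List κ) :
    CompTree ι d :=
  cs.foldr (fun c T => ifNonpos (tests c) (.output (w c)) T) (.output fun _ => .const 0)

theorem exists_run_search_eq {κ : Type*} (x : ι → ℝ) (w : κ → Fin d → Expr ι)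
    (tests : κ → List (Expr ι)) (cs : List κ)
    (h : ∃ c ∈ cs, ∀ t ∈ tests c, t.eval x ≤ 0) :
    ∃ c ∈ cs, (∀ t ∈ tests c, t.eval x ≤ 0) ∧
      (search w tests cs).run x = fun j => (w c j).eval x := by
  classical
  induction cs with
  | nil => simp at h
  | cons c cs ih =>
    change ∃ c' ∈ c :: cs, _ ∧
      (ifNonpos (tests c) (output (w c)) (search w tests cs)).run x = _
    rw [run_ifNonpos]
    by_cases hc : ∀ t ∈ tests c, t.eval x ≤ 0
    · exact ⟨c, by simp, hc, by rw [if_pos hc, run]⟩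
    · obtain ⟨c', hc', h'⟩ := h
      have hmem : c' ∈ cs := by
        rcases List.mem_cons.1 hc' with rfl | h1
        · exact absurd h' hc
        · exact h1
      obtain ⟨c₁, h₁, h₂, h₃⟩ := ih ⟨c', hmem, h'⟩
      exact ⟨c₁, by simp [h₁], h₂, by rw [if_neg hc, h₃]⟩

theorem steps_search_le {κ : Type*} {M K L : ℕ} (x : ι → ℝ) (w : κ → Fin d → Expr ι)
    (tests : κ → List (Expr ι)) (cs : List κ) (hM : ∀ c, (tests c).length ≤ M)
    (hK : ∀ c, ∀ t ∈ tests c, t.steps ≤ K) (hL : ∀ c j, (w c j).steps ≤ L) :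
    (search w tests cs).steps x ≤ cs.length * (M * (K + 1) + (1 + d * L)) + (1 + d) := by
  induction cs with
  | nil => simp [search, steps, Expr.steps]
  | cons c cs ih =>
    change (ifNonpos (tests c) (output (w c)) (search w tests cs)).steps x ≤ _
    have h1 := steps_ifNonpos_le (K := K) x (tests c) (.output (w c)) (search w tests cs) (hK c)
    have h2 : (output (w c)).steps x ≤ 1 + d * L := by
      have : ∑ j, (w c j).steps ≤ ∑ _j : Fin d, L := Finset.sum_le_sum fun j _ => hL c j
      simpa [steps] using this
    have h3 := Nat.mul_le_mul_right (K + 1) (hM c)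
    simp only [List.length_cons, Nat.succ_mul]
    omega

end CompTree

/-! ### Testing on the examples that were not used -/

/-- If a hypothesis is determined by the examples in `I`, the probability that its error exceeds
`ε` although it is correct on all other examples is at most `(1 - ε) ^ |Iᶜ|`. -/
theorem pi_holdout_le {X : Type v} [MeasurableSpace X] (D : Measure X) [IsProbabilityMeasure D]
    {ι : Type*} [Fintype ι] [DecidableEq ι] (I : Finset ι) (Q : (ι → X) → X → Prop)
    (hQ : MeasurableSet {p : (ι → X) × X | Q p.1 p.2})
    (hdep : ∀ x y : ι → X, (∀ i ∈ I, x i = y i) → Q x = Q y) {ε : ℝ} (hε : 0 ≤ ε) :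
    Measure.pi (fun _ : ι => D)
      {x | ENNReal.ofReal ε < D {z | ¬ Q x z} ∧ ∀ i, Q x (x i)} ≤
      ENNReal.ofReal (1 - ε) ^ (Fintype.card ι - I.card) := by
  have hB : MeasurableSet {x : ι → X | ENNReal.ofReal ε < D {z | ¬ Q x z} ∧ ∀ i, Q x (x i)} := by
    have h1 : MeasurableSet {x : ι → X | ENNReal.ofReal ε < D {z | ¬ Q x z}} :=
      measurableSet_lt measurable_const (measurable_measure_prodMk_left hQ.compl)
    have h2 : MeasurableSet {x : ι → X | ∀ i, Q x (x i)} := by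
      rw [Set.ofPred_forall]
      exact MeasurableSet.iInter fun i => (measurable_id.prodMk (measurable_pi_apply i)) hQ
    exact h1.inter h2
  -- Fubini: fix the coordinates `y` in `I` and integrate over the others.
  have hmp := (measurePreserving_piEquivPiSubtypeProd (fun _ : ι => D) (· ∈ I)).symm
  rw [← hmp.measure_preimage_equiv, Measure.prod_apply (MeasurableEquiv.measurable _ hB)]
  refine (lintegral_mono (g := fun _ => ENNReal.ofReal (1 - ε) ^ (Fintype.card ι - I.card))
    fun y => ?_).trans (by simp)
  set e := (MeasurableEquiv.piEquivPiSubtypeProd (fun _ : ι => X) (· ∈ I)).symm with he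
  -- A point `z₀` of a nonempty slice serves as reference. By `hdep` the predicate is the same on
  -- the whole slice, so the slice lies in a box whose sides each have measure at most `1 - ε`.
  rcases Set.eq_empty_or_nonempty (Prod.mk y ⁻¹' (e ⁻¹'
    {x | ENNReal.ofReal ε < D {z | ¬ Q x z} ∧ ∀ i, Q x (x i)})) with h | ⟨z₀, hz₀, -⟩
  · rw [h]
    simp
  have hQ₀ : MeasurableSet {z | Q (e (y, z₀)) z} := measurable_prodMk_left hQ
  have hsub : Prod.mk y ⁻¹' (e ⁻¹' {x | ENNReal.ofReal ε < D {z | ¬ Q x z} ∧ ∀ i, Q x (x i)}) ⊆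
      Set.univ.pi fun _ : {i // i ∉ I} => {z | Q (e (y, z₀)) z} := by
    rintro z ⟨-, hz⟩ i -
    have h1 := hz i
    rw [hdep (e (y, z)) (e (y, z₀)) fun i hi => by
      simp [e, MeasurableEquiv.piEquivPiSubtypeProd, Equiv.piEquivPiSubtypeProd, hi]] at h1
    simpa [e, MeasurableEquiv.piEquivPiSubtypeProd, Equiv.piEquivPiSubtypeProd, i.2] using h1
  refine (measure_mono hsub).trans ?_
  rw [Measure.pi_pi, Finset.prod_const, Finset.card_univ,
    Fintype.card_subtype_compl, Fintype.card_coe]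
  refine pow_le_pow_left' ?_ _
  have hc : D {z | Q (e (y, z₀)) z} = 1 - D {z | ¬ Q (e (y, z₀)) z} := by
    have := prob_compl_eq_one_sub (μ := D) hQ₀.compl
    rwa [compl_compl] at this
  rw [hc, ENNReal.ofReal_sub _ hε, ENNReal.ofReal_one]
  exact tsub_le_tsub_left hz₀.le _

/-! ### The learner: basic solutions of the consistency constraints -/

namespace GraphFamily

variable {V : Type u} {X : Type v} [MeasurableSpace X] {d : ℕ}

/-- Choosing the maximizer of least rank means that edges of smaller rank must be beaten strictly.
This is what makes consistency a linear system. -/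
theorem h_eq_iff [Finite V] (F : GraphFamily V X d) (w : Fin d → ℝ) (x : X) (e : V × V) :
    F.h w x = e ↔ e ∈ F.E x ∧ ∀ e' ∈ F.E x, w ⬝ᵥ F.φ x e' ≤ w ⬝ᵥ F.φ x e ∧
      (F.rank e' < F.rank e → w ⬝ᵥ F.φ x e' < w ⬝ᵥ F.φ x e) := by
  have hmem : F.h w x ∈ F.maximizers w x :=
    Function.argminOn_mem F.rank _ (F.maximizers_nonempty w x)
  have hle : ∀ e' ∈ F.maximizers w x, F.rank (F.h w x) ≤ F.rank e' := fun e' he' =>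
    Function.argminOn_le F.rank _ he'
  constructor
  · rintro rfl
    refine ⟨hmem.1, fun e' he' => ⟨hmem.2 e' he', fun hr => ?_⟩⟩
    refine lt_of_le_of_ne (hmem.2 e' he') fun heq => ?_
    exact absurd (hle e' ⟨he', fun e'' he'' => (hmem.2 e'' he'').trans heq.ge⟩) (not_le.2 hr)
  · rintro ⟨he, hmax⟩
    have h1 := hle e ⟨he, fun e' he' => (hmax e' he').1⟩
    by_contra hne
    have h2 : F.rank (F.h w x) < F.rank e := lt_of_le_of_ne h1 fun h => hne (F.rank.injective h)
    exact absurd (hmem.2 e he) (not_le.2 ((hmax _ hmem.1).2 h2))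

theorem h_mem_Emax [Finite V] (F : GraphFamily V X d) (w : Fin d → ℝ) (x : X) :
    F.h w x ∈ F.Emax :=
  Set.mem_iUnion.2 ⟨x, ((F.h_eq_iff w x _).1 rfl).1⟩

theorem exists_adj_of_mem_Emax (F : GraphFamily V X d) {e : V × V} (he : e ∈ F.Emax) :
    ∃ x, (F.graph x).Adj e.1 e.2 := by
  obtain ⟨x, hx⟩ := Set.mem_iUnion.1 (show e ∈ ⋃ x, F.E x from he)
  exact ⟨x, hx⟩

/-- A pair of edges of an example, the first of which is to be preferred. -/
abbrev Comparison (F : GraphFamily V X d) (m : ℕ) : Type u :=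
  Fin m × F.Emax × F.Emax

/-- The margin by which `e` has to be preferred to `e'`. -/
def margin (F : GraphFamily V X d) (e e' : V × V) : ℚ :=
  if F.rank e' < F.rank e then 1 else 0

/-- The normal vector of a comparison, or a unit vector. -/
def row (F : GraphFamily V X d) {m : ℕ} (x : Fin m → X) :
    F.Comparison m ⊕ Fin d → Fin d → ℝ :=
  Sum.elim (fun s j => F.φ (x s.1) s.2.1 j - F.φ (x s.1) s.2.2 j) fun k => Pi.single k 1

/-- The right-hand side that belongs to a row. -/
def rhs (F : GraphFamily V X d) {m : ℕ} : F.Comparison m ⊕ Fin d → ℝ :=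
  Sum.elim (fun s => (F.margin s.2.1 s.2.2 : ℝ)) fun _ => 0

/-- The weight vector that is determined by a choice of `d` rows. -/
def weight (F : GraphFamily V X d) {m : ℕ} (c : Fin d → F.Comparison m ⊕ Fin d)
    (x : Fin m → X) : Fin d → ℝ :=
  cramerSolution (Matrix.of fun k => F.row x (c k)) fun k => F.rhs (c k)

/-- The expressions for the entries of a row. -/
def rowExpr (F : GraphFamily V X d) {m : ℕ} :
    F.Comparison m ⊕ Fin d → Fin d → Expr (F.InputIndex m) :=
  Sum.elim (fun s j => .sub (.input (.metric s.1 s.2.1 j)) (.input (.metric s.1 s.2.2 j)))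
    fun k j => .const (if j = k then 1 else 0)

/-- The expression for the right-hand side of a row. -/
def rhsExpr (F : GraphFamily V X d) {m : ℕ} :
    F.Comparison m ⊕ Fin d → Expr (F.InputIndex m) :=
  Sum.elim (fun s => .const (F.margin s.2.1 s.2.2)) fun _ => .const 0

/-- The expressions for the weight vector determined by a choice of `d` rows. -/
def weightExpr (F : GraphFamily V X d) {m : ℕ} (c : Fin d → F.Comparison m ⊕ Fin d) :
    Fin d → Expr (F.InputIndex m) :=
  Expr.cramer (fun k => F.rowExpr (c k)) fun k => F.rhsExpr (c k)

/-- An expression that is positive if the weights `w` violate the comparison `s`. -/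
def testExpr (F : GraphFamily V X d) {m : ℕ} (w : Fin d → Expr (F.InputIndex m))
    (s : F.Comparison m) : Expr (F.InputIndex m) :=
  .mul (.mul (.input (.isEdge s.1 s.2.2)) (.input (.isLabel s.1 s.2.1)))
    (.sub (F.rhsExpr (.inl s))
      (.listSum ((List.finRange d).map fun j => .mul (F.rowExpr (.inl s) j) (w j))))

theorem eval_rowExpr (F : GraphFamily V X d) {m : ℕ} (S : Fin m → X × (V × V))
    (s : F.Comparison m ⊕ Fin d) (j : Fin d) :
    (F.rowExpr s j).eval (F.encode S) = F.row (fun i => (S i).1) s j := by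
  rcases s with s | k
  · rfl
  · by_cases h : j = k <;> simp [rowExpr, row, Expr.eval, h]

theorem eval_rhsExpr (F : GraphFamily V X d) {m : ℕ} (S : Fin m → X × (V × V))
    (s : F.Comparison m ⊕ Fin d) : (F.rhsExpr s).eval (F.encode S) = F.rhs s := by
  rcases s with s | k
  · rfl
  · simp [rhsExpr, rhs, Expr.eval]

theorem eval_weightExpr (F : GraphFamily V X d) {m : ℕ} (S : Fin m → X × (V × V))
    (c : Fin d → F.Comparison m ⊕ Fin d) :
    (fun j => (F.weightExpr c j).eval (F.encode S)) = F.weight c fun i => (S i).1 := by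
  simp only [weightExpr, Expr.eval_cramer, weight, eval_rowExpr, eval_rhsExpr]

/-- The two indicator factors make the expression `0`, hence the test vacuous, unless the second
edge is present and the first is the label. -/
theorem eval_testExpr_nonpos_iff (F : GraphFamily V X d) {m : ℕ} (S : Fin m → X × (V × V))
    (w : Fin d → Expr (F.InputIndex m)) (s : F.Comparison m) :
    (F.testExpr w s).eval (F.encode S) ≤ 0 ↔
      ((s.2.2 : V × V) ∈ F.E (S s.1).1 → (s.2.1 : V × V) = (S s.1).2 →
        F.rhs (.inl s) ≤
          F.row (fun i => (S i).1) (.inl s) ⬝ᵥ fun j => (w j).eval (F.encode S)) := by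
  have hsum : (Expr.listSum ((List.finRange d).map fun j =>
      Expr.mul (F.rowExpr (.inl s) j) (w j))).eval (F.encode S) =
      F.row (fun i => (S i).1) (.inl s) ⬝ᵥ fun j => (w j).eval (F.encode S) := by
    simp [Expr.eval_listSum, dotProduct, Fin.sum_univ_def, Function.comp_def, Expr.eval,
      eval_rowExpr]
  simp only [testExpr, Expr.eval, hsum, eval_rhsExpr, encode]
  by_cases h1 : (s.2.2 : V × V) ∈ F.E (S s.1).1 <;>
    by_cases h2 : (s.2.1 : V × V) = (S s.1).2 <;> simp [h1, h2]

theorem row_inl_dotProduct (F : GraphFamily V X d) {m : ℕ} (x : Fin m → X) (s : F.Comparison m)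
    (w : Fin d → ℝ) :
    F.row x (.inl s) ⬝ᵥ w = w ⬝ᵥ F.φ (x s.1) s.2.1 - w ⬝ᵥ F.φ (x s.1) s.2.2 := by
  rw [← dotProduct_sub, dotProduct_comm]
  rfl

/-! ### Cost, dependence on examples and measurability of a candidate weight vector -/

section Expressions

variable (F : GraphFamily V X d) {m : ℕ}

/-- A bound on the steps for computing one candidate weight. -/
def weightSteps (d : ℕ) : ℕ := 2 * Expr.detSteps d 3 + 1

theorem steps_rowExpr_le (s : F.Comparison m ⊕ Fin d) (j : Fin d) :
    (F.rowExpr s j).steps ≤ 3 := by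
  rcases s with s | k <;> simp [rowExpr, Expr.steps]

theorem steps_rhsExpr (s : F.Comparison m ⊕ Fin d) : (F.rhsExpr s).steps = 1 := by
  rcases s with s | k <;> simp [rhsExpr, Expr.steps]

theorem steps_weightExpr_le (c : Fin d → F.Comparison m ⊕ Fin d) (j : Fin d) :
    (F.weightExpr c j).steps ≤ weightSteps d :=
  Expr.steps_cramer_le _ _ (fun k => F.steps_rowExpr_le (c k))
    (fun k => by rw [steps_rhsExpr]; norm_num) j

theorem steps_testExpr_le (c : Fin d → F.Comparison m ⊕ Fin d) (s : F.Comparison m) :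
    (F.testExpr (F.weightExpr c) s).steps ≤ d * (weightSteps d + 5) + 7 := by
  have h := Expr.steps_listSum_le (K := weightSteps d + 4)
    ((List.finRange d).map fun j => Expr.mul (F.rowExpr (.inl s) j) (F.weightExpr c j)) (by
      simp only [List.mem_map, forall_exists_index, and_imp]
      rintro _ j - rfl
      have h1 := F.steps_rowExpr_le (m := m) (.inl s) j
      have h2 := F.steps_weightExpr_le c j
      simp only [Expr.steps]
      omega)
  simp only [List.length_map, List.length_finRange, add_assoc, Nat.reduceAdd] at h
  simp only [testExpr, Expr.steps, steps_rhsExpr]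
  omega

/-- The examples on which a choice of rows depends. -/
def support (c : Fin d → F.Comparison m ⊕ Fin d) : Finset (Fin m) :=
  Finset.univ.biUnion fun k => Sum.elim (fun s => {s.1}) (fun _ => ∅) (c k)

theorem card_support_le (c : Fin d → F.Comparison m ⊕ Fin d) : (F.support c).card ≤ d := by
  refine (Finset.card_biUnion_le_card_mul _ _ 1 fun k _ => ?_).trans (by simp)
  rcases c k with s | j <;> simp

/-- Right-hand sides depend only on ranks, so a candidate sees the sample only through the metrics
of the examples in its rows. This supplies the hypothesis `hdep` of `pi_holdout_le`. -/
theorem weight_congr (c : Fin d → F.Comparison m ⊕ Fin d) {x y : Fin m → X}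
    (hxy : ∀ i ∈ F.support c, x i = y i) : F.weight c x = F.weight c y := by
  have hrow : ∀ k, F.row x (c k) = F.row y (c k) := fun k => by
    have hk : ∀ i ∈ Sum.elim (fun s : F.Comparison m => ({s.1} : Finset (Fin m)))
        (fun _ => ∅) (c k), x i = y i := fun i hi =>
      hxy i (Finset.mem_biUnion.2 ⟨k, Finset.mem_univ _, hi⟩)
    rcases hck : c k with s | j
    · rw [hck] at hk
      have := hk s.1 (by simp)
      simp only [row, Sum.elim_inl, this]
    · rfl
  simp only [weight, hrow]

theorem measurable_weight (c : Fin d → F.Comparison m ⊕ Fin d) : Measurable (F.weight c) := by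
  have hrow : ∀ s j, Measurable fun x : Fin m → X => F.row x s j := by
    rintro (s | k) j
    · have h1 := F.measurable_φ s.2.1 (F.exists_adj_of_mem_Emax s.2.1.2) j
      have h2 := F.measurable_φ s.2.2 (F.exists_adj_of_mem_Emax s.2.2.2) j
      exact (h1.comp (measurable_pi_apply s.1)).sub (h2.comp (measurable_pi_apply s.1))
    · exact measurable_const
  have hdet : ∀ A : (Fin m → X) → Matrix (Fin d) (Fin d) ℝ,
      (∀ i j, Measurable fun x => A x i j) → Measurable fun x => (A x).det := by
    intro A hA
    simp only [Matrix.det_apply']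
    exact Finset.measurable_sum _ fun σ _ =>
      (Finset.measurable_prod _ fun i _ => hA _ _).const_mul _
  refine measurable_pi_lambda _ fun j => (hdet _ fun i k => ?_).div (hdet _ fun i k => hrow _ _)
  simp only [Matrix.updateCol_apply]
  split_ifs
  · exact measurable_const
  · exact hrow _ _

end Expressions

/-! ### Success and running time of the search -/

section Learner

variable [Finite V] (F : GraphFamily V X d) {m : ℕ}

/-- On a realizable sample some choice of rows yields weights that pass all tests. -/
theorem exists_tests_nonpos (S : Fin m → X × (V × V)) (w₀ : Fin d → ℝ)
    (hS : ∀ i, F.h w₀ (S i).1 = (S i).2) :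
    ∃ c : Fin d → F.Comparison m ⊕ Fin d,
      ∀ s, (F.testExpr (F.weightExpr c) s).eval (F.encode S) ≤ 0 := by
  let x : Fin m → X := fun i => (S i).1
  -- Only these comparisons are demanded by the labels. The search nevertheless ranges over all
  -- comparisons, so that its candidates are indexed independently of the sample, as the union bound
  -- requires.
  let A := {s : F.Comparison m // (s.2.2 : V × V) ∈ F.E (x s.1) ∧ (s.2.1 : V × V) = (S s.1).2}
  have hA : ∀ s : A, w₀ ⬝ᵥ F.φ (x s.1.1) s.1.2.2 ≤ w₀ ⬝ᵥ F.φ (x s.1.1) s.1.2.1 ∧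
      (F.rank s.1.2.2 < F.rank s.1.2.1 →
        w₀ ⬝ᵥ F.φ (x s.1.1) s.1.2.2 < w₀ ⬝ᵥ F.φ (x s.1.1) s.1.2.1) := fun s =>
    ((F.h_eq_iff w₀ (x s.1.1) s.1.2.1).1 (by rw [s.2.2, hS])).2 _ s.2.1
  obtain ⟨w₁, hw₁⟩ := exists_feasible_with_margin (fun s : A => F.row x (.inl s.1))
    (fun s => F.rank s.1.2.2 < F.rank s.1.2.1) w₀
    (fun s => by rw [row_inl_dotProduct]; exact sub_nonneg.2 (hA s).1)
    (fun s hs => by rw [row_inl_dotProduct]; exact sub_pos.2 ((hA s).2 hs))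
  have hw₁' : ∀ s : A, F.rhs (.inl s.1) ≤ F.row x (.inl s.1) ⬝ᵥ w₁ := fun s => by
    refine le_of_eq_of_le ?_ (hw₁ s)
    simp only [rhs, Sum.elim_inl, margin]
    split_ifs <;> simp
  obtain ⟨w, r, hw, hdet, hr⟩ := exists_basic_solution (fun s : A => F.row x (.inl s.1))
    (fun s => F.rhs (.inl s.1)) w₁ hw₁'
  have hrow : ∀ k, F.row x (Sum.map Subtype.val id (r k)) =
      Sum.elim (fun s : A => F.row x (.inl s.1)) (fun j => Pi.single j 1) (r k) := fun k => by
    rcases r k with s | j <;> rfl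
  have hrhs : ∀ k, F.rhs (Sum.map Subtype.val id (r k)) =
      Sum.elim (fun s : A => F.rhs (.inl s.1)) (fun _ => 0) (r k) := fun k => by
    rcases r k with s | j <;> rfl
  have hweight : F.weight (fun k => Sum.map Subtype.val id (r k)) x = w := by
    refine cramerSolution_eq ?_ (funext fun k => ?_)
    · simpa only [hrow] using hdet
    · rw [hrhs, ← hr, ← hrow]
      rfl
  refine ⟨fun k => Sum.map Subtype.val id (r k), fun s => ?_⟩
  rw [eval_testExpr_nonpos_iff, eval_weightExpr]
  intro h1 h2
  refine (hw ⟨s, h1, h2⟩).trans_eq ?_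
  rw [← hweight]

/-- Weights that pass all tests are consistent with the sample. -/
theorem h_weight_eq_of_tests_nonpos (S : Fin m → X × (V × V)) (hS : ∀ i, (S i).2 ∈ F.E (S i).1)
    (c : Fin d → F.Comparison m ⊕ Fin d)
    (hc : ∀ s, (F.testExpr (F.weightExpr c) s).eval (F.encode S) ≤ 0) (i : Fin m) :
    F.h (F.weight c fun i => (S i).1) (S i).1 = (S i).2 := by
  refine (F.h_eq_iff _ _ _).2 ⟨hS i, fun e' he' => ?_⟩
  have h := (F.eval_testExpr_nonpos_iff S _ (i, ⟨(S i).2, Set.mem_iUnion.2 ⟨_, hS i⟩⟩,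
    ⟨e', Set.mem_iUnion.2 ⟨_, he'⟩⟩)).1 (hc _) he' rfl
  rw [eval_weightExpr, row_inl_dotProduct] at h
  simp only [rhs, Sum.elim_inl, margin] at h
  constructor
  · split_ifs at h <;> push_cast at h <;> linarith
  · intro hr
    rw [if_pos hr] at h
    push_cast at h
    linarith

instance : Fintype (F.Comparison m) := Fintype.ofFinite _

/-- The tree that outputs the first weight vector which passes all tests. -/
def tree (m : ℕ) : CompTree (F.InputIndex m) d :=
  CompTree.search F.weightExpr
    (fun c => (Finset.univ : Finset (F.Comparison m)).toList.map (F.testExpr (F.weightExpr c)))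
    (Finset.univ : Finset (Fin d → F.Comparison m ⊕ Fin d)).toList

/-- Wherever the search stops, its output is one of the finitely many candidates and passes all
tests. A singular choice of rows also yields some vector, as division by zero gives zero; this is
harmless because only the tests matter. -/
theorem exists_tree_run_eq (x : Fin m → X) (w₀ : Fin d → ℝ) :
    ∃ c : Fin d → F.Comparison m ⊕ Fin d,
      (F.tree m).run (F.encode (labelled (F.h w₀) x)) = F.weight c x ∧
      ∀ i, F.h (F.weight c x) (x i) = F.h w₀ (x i) := by
  obtain ⟨c₀, hc₀⟩ := F.exists_tests_nonpos (labelled (F.h w₀) x) w₀ fun _ => rfl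
  obtain ⟨c, -, hc, hrun⟩ := CompTree.exists_run_search_eq (F.encode (labelled (F.h w₀) x))
    F.weightExpr (fun c => (Finset.univ : Finset (F.Comparison m)).toList.map
      (F.testExpr (F.weightExpr c)))
    (Finset.univ : Finset (Fin d → F.Comparison m ⊕ Fin d)).toList
    ⟨c₀, by simp, fun t ht => by
      obtain ⟨s, -, rfl⟩ := List.mem_map.1 ht
      exact hc₀ s⟩
  refine ⟨c, hrun.trans (F.eval_weightExpr _ c), fun i => ?_⟩
  exact F.h_weight_eq_of_tests_nonpos (labelled (F.h w₀) x)
    (fun i => ((F.h_eq_iff w₀ (x i) _).1 rfl).1) c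
    (fun s => hc _ (List.mem_map.2 ⟨s, by simp, rfl⟩)) i

theorem card_comparison : Fintype.card (F.Comparison m) = m * F.Emax.ncard ^ 2 := by
  rw [← Nat.card_eq_fintype_card, Nat.card_prod, Nat.card_prod, Nat.card_fin,
    Nat.card_coe_set_eq, sq]

theorem card_choice :
    Fintype.card (Fin d → F.Comparison m ⊕ Fin d) = (m * F.Emax.ncard ^ 2 + d) ^ d := by
  rw [Fintype.card_fun, Fintype.card_sum, card_comparison, Fintype.card_fin]

theorem steps_tree_le (x : F.InputIndex m → ℝ) :
    (F.tree m).steps x ≤ (m * F.Emax.ncard ^ 2 + d) ^ d *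
      (m * F.Emax.ncard ^ 2 * (d * (weightSteps d + 5) + 8) + (1 + d * weightSteps d)) +
        (1 + d) := by
  have h := CompTree.steps_search_le (M := m * F.Emax.ncard ^ 2)
    (K := d * (weightSteps d + 5) + 7) (L := weightSteps d) x F.weightExpr
    (fun c => (Finset.univ : Finset (F.Comparison m)).toList.map (F.testExpr (F.weightExpr c)))
    (Finset.univ : Finset (Fin d → F.Comparison m ⊕ Fin d)).toList
    (fun c => by simp [-Fintype.card_prod, card_comparison])
    (fun c t ht => by
      obtain ⟨s, -, rfl⟩ := List.mem_map.1 ht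
      exact F.steps_testExpr_le c s)
    F.steps_weightExpr_le
  rwa [Finset.length_toList, Finset.card_univ, card_choice] at h

end Learner

/-! ### Error of the learner -/

section Error

variable [Finite V] (F : GraphFamily V X d) {m : ℕ}

/-- Joint measurability is needed because the weights are themselves functions of the random sample.
Comparisons are restricted to `F.Emax`, where the metrics are known to be measurable. -/
theorem measurableSet_h_eq (e : V × V) :
    MeasurableSet {p : (Fin d → ℝ) × X | F.h p.1 p.2 = e} := by
  have hE : ∀ e' : V × V, MeasurableSet {p : (Fin d → ℝ) × X | e' ∈ F.E p.2} := fun e' =>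
    measurable_snd (F.measurableSet_adj e')
  have hdot : ∀ e' ∈ F.Emax, Measurable fun p : (Fin d → ℝ) × X => p.1 ⬝ᵥ F.φ p.2 e' := by
    intro e' he'
    have hφ := F.measurable_φ e' (F.exists_adj_of_mem_Emax he')
    exact Finset.measurable_sum _ fun j _ => ((measurable_pi_apply j).comp measurable_fst).mul
      ((hφ j).comp measurable_snd)
  by_cases he : e ∈ F.Emax
  · have heq : {p : (Fin d → ℝ) × X | F.h p.1 p.2 = e} = {p | e ∈ F.E p.2} ∩
        ⋂ e' ∈ F.Emax, ({p | e' ∈ F.E p.2}ᶜ ∪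
          ({p | p.1 ⬝ᵥ F.φ p.2 e' ≤ p.1 ⬝ᵥ F.φ p.2 e} ∩
            ({_p | F.rank e' < F.rank e}ᶜ ∪ {p | p.1 ⬝ᵥ F.φ p.2 e' < p.1 ⬝ᵥ F.φ p.2 e}))) := by
      ext p
      simp only [Set.mem_ofPred_eq, h_eq_iff, Set.mem_inter_iff, Set.mem_iInter, Set.mem_union,
        Set.mem_compl_iff, ← imp_iff_not_or]
      exact and_congr_right fun _ => ⟨fun h e' _ => h e',
        fun h e' he' => h e' (Set.mem_iUnion.2 ⟨_, he'⟩) he'⟩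
    rw [heq]
    refine (hE e).inter (MeasurableSet.biInter (Set.to_countable _) fun e' he' =>
      (hE e').compl.union ((measurableSet_le (hdot e' he') (hdot e he)).inter
        ((MeasurableSet.const _).compl.union (measurableSet_lt (hdot e' he') (hdot e he)))))
  · convert MeasurableSet.empty
    ext p
    simp only [Set.mem_ofPred_eq, Set.mem_empty_iff_false, iff_false]
    rintro rfl
    exact he (F.h_mem_Emax _ _)

theorem measurableSet_h_eq_h (w₀ : Fin d → ℝ) :
    MeasurableSet {p : (Fin d → ℝ) × X | F.h p.1 p.2 = F.h w₀ p.2} := by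
  have heq : {p : (Fin d → ℝ) × X | F.h p.1 p.2 = F.h w₀ p.2} =
      ⋃ e, ({p | F.h p.1 p.2 = e} ∩ {p | F.h w₀ p.2 = e}) := by
    ext p
    simp [eq_comm]
  rw [heq]
  refine MeasurableSet.iUnion fun e => (F.measurableSet_h_eq e).inter ?_
  exact (measurable_const.prodMk measurable_snd :
    Measurable fun p : (Fin d → ℝ) × X => (w₀, p.2)) (F.measurableSet_h_eq e)

/-- The probability that the learner errs by more than `ε`, for labels given by a hypothesis. -/
theorem pi_error_le (D : Measure X) [IsProbabilityMeasure D] (w₀ : Fin d → ℝ) {ε : ℝ}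
    (hε : ε ∈ Set.Ioo (0 : ℝ) 1) (m : ℕ) :
    Measure.pi (fun _ : Fin m => D)
      {x | ENNReal.ofReal ε <
        trueError D (F.h w₀) (F.learner F.tree m (labelled (F.h w₀) x))} ≤
      ENNReal.ofReal (((m : ℝ) * F.Emax.ncard ^ 2 + d) ^ d * (1 - ε) ^ (m - d)) := by
  classical
  have hsub : {x : Fin m → X | ENNReal.ofReal ε <
        trueError D (F.h w₀) (F.learner F.tree m (labelled (F.h w₀) x))} ⊆
      ⋃ c ∈ (Finset.univ : Finset (Fin d → F.Comparison m ⊕ Fin d)),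
        {x | ENNReal.ofReal ε < D {z | ¬ F.h (F.weight c x) z = F.h w₀ z} ∧
          ∀ i, F.h (F.weight c x) (x i) = F.h w₀ (x i)} := by
    intro x hx
    obtain ⟨c, hrun, hc⟩ := F.exists_tree_run_eq x w₀
    refine Set.mem_biUnion (Finset.mem_coe.2 (Finset.mem_univ c)) ⟨?_, hc⟩
    rw [Set.mem_ofPred_eq, learner, hrun] at hx
    exact hx
  refine (measure_mono hsub).trans ((measure_biUnion_finset_le _ _).trans ?_)
  have hone : ∀ c : Fin d → F.Comparison m ⊕ Fin d, Measure.pi (fun _ : Fin m => D)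
      {x | ENNReal.ofReal ε < D {z | ¬ F.h (F.weight c x) z = F.h w₀ z} ∧
          ∀ i, F.h (F.weight c x) (x i) = F.h w₀ (x i)} ≤ ENNReal.ofReal ((1 - ε) ^ (m - d)) := by
    intro c
    refine (pi_holdout_le D (F.support c) (fun x z => F.h (F.weight c x) z = F.h w₀ z) ?_ ?_
      hε.1.le).trans ?_
    · exact ((F.measurable_weight c).comp measurable_fst).prodMk measurable_snd
        (F.measurableSet_h_eq_h w₀)
    · intro x y hxy
      simp only [F.weight_congr c hxy]
    · rw [ENNReal.ofReal_pow (by linarith [hε.2]), Fintype.card_fin]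
      -- The support may have fewer than `d` examples; the exponent `m - d` serves all candidates
      -- uniformly.
      refine pow_le_pow_right_of_le_one' (ENNReal.ofReal_le_one.2 (by linarith [hε.1])) ?_
      exact Nat.sub_le_sub_left (F.card_support_le c) m
  refine (Finset.sum_le_sum fun c _ => hone c).trans ?_
  rw [Finset.sum_const, Finset.card_univ, card_choice, nsmul_eq_mul,
    ENNReal.ofReal_mul (by positivity), ← ENNReal.ofReal_natCast]
  push_cast
  exact le_rfl

end Error

end GraphFamily

/-! ### Sample complexity -/

/-- The bound on the sample size. -/
def sampleBound (n d : ℕ) (ε δ : ℝ) : ℝ :=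
  16 * (((n : ℝ) * d * Real.log ((n : ℝ) * d / ε) ^ 2 + Real.log (1 / δ)) / ε)

theorem log_one_div_pos {δ : ℝ} (hδ : δ ∈ Set.Ioo (0 : ℝ) 1) : 0 < Real.log (1 / δ) :=
  Real.log_pos ((one_lt_div hδ.1).2 hδ.2)

theorem sampleBound_nonneg (n d : ℕ) {ε δ : ℝ} (hε : ε ∈ Set.Ioo (0 : ℝ) 1)
    (hδ : δ ∈ Set.Ioo (0 : ℝ) 1) : 0 ≤ sampleBound n d ε δ := by
  have h1 := log_one_div_pos hδ
  have h2 := hε.1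
  unfold sampleBound
  positivity

/-- Bounding logarithms by their arguments makes the sample size polynomial in `n`, `1/ε` and `1/δ`,
as the step count requires. -/
theorem sampleBound_le (n d : ℕ) {ε δ : ℝ} (hε : ε ∈ Set.Ioo (0 : ℝ) 1)
    (hδ : δ ∈ Set.Ioo (0 : ℝ) 1) :
    sampleBound n d ε δ ≤
      16 * (((n : ℝ) * d * ((n : ℝ) * d * (1 / ε)) ^ 2 + 1 / δ) * (1 / ε)) := by
  have hε0 := hε.1
  have hδ0 := hδ.1
  have hlog : Real.log ((n : ℝ) * d / ε) ^ 2 ≤ ((n : ℝ) * d * (1 / ε)) ^ 2 := by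
    rw [mul_one_div]
    rcases Nat.eq_zero_or_pos (n * d) with h | h
    · have : (n : ℝ) * d = 0 := by exact_mod_cast h
      simp [this]
    · have h1 : (1 : ℝ) ≤ (n : ℝ) * d := by exact_mod_cast h
      have h2 : 1 ≤ (n : ℝ) * d / ε := (one_le_div hε0).2 (by linarith [hε.2])
      exact pow_le_pow_left₀ (Real.log_nonneg h2) (Real.log_le_self (by linarith)) 2
  have hlog' : Real.log (1 / δ) ≤ 1 / δ := Real.log_le_self (by positivity)
  rw [sampleBound, div_eq_mul_one_div _ ε]
  gcongr

/-- From the sample size on, the union bound over the candidates is at most `δ`. -/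
theorem candidates_mul_pow_le {n d m : ℕ} {ε δ : ℝ} (hn : 2 ≤ n) (hd : 1 ≤ d)
    (hε : ε ∈ Set.Ioo (0 : ℝ) 1) (hδ : δ ∈ Set.Ioo (0 : ℝ) 1)
    (hm : ⌊sampleBound n d ε δ⌋₊ ≤ m) :
    ((m : ℝ) * n ^ 2 + d) ^ d * (1 - ε) ^ (m - d) ≤ δ := by
  obtain ⟨hε0, hε1⟩ := hε
  have hδ0 := hδ.1
  have hn' : (2 : ℝ) ≤ n := by exact_mod_cast hn
  have hd' : (1 : ℝ) ≤ d := by exact_mod_cast hd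
  set L := Real.log ((n : ℝ) * d / ε) with hL
  set R := Real.log (1 / δ) with hR
  have hR0 : 0 < R := log_one_div_pos hδ
  have hnd : (2 : ℝ) ≤ n * d := by nlinarith
  have hmono : ∀ y : ℝ, 0 < y → y * ε ≤ n * d → Real.log y ≤ L := fun y hy h =>
    Real.log_le_log hy ((le_div_iff₀ hε0).2 h)
  -- Here `n * d ≥ 2` keeps `L` away from `0`; with `n * d = 1` and `ε` near `1` it would not be.
  have hL2 : Real.log 2 ≤ L := hmono 2 (by norm_num) (by nlinarith)
  have hLhalf : 1 / 2 ≤ L := by linarith [Real.log_two_gt_d9]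
  have hdL : (d : ℝ) ≤ 2 * (d * L) := by nlinarith
  have hndL : d * L ≤ n * d * L ^ 2 := by
    have h1 : 1 ≤ n * L := by nlinarith
    have h2 : 0 ≤ d * L := by positivity
    calc d * L ≤ (n * L) * (d * L) := le_mul_of_one_le_left h2 h1
      _ = n * d * L ^ 2 := by ring
  -- Rounding down costs less than `ε < 1 ≤ 2 * (d * L)`, which lowers the coefficient from `16` to
  -- `14`.
  have hεm : 14 * (d * L) + 16 * R ≤ ε * m := by
    have h1 : sampleBound n d ε δ < m + 1 :=
      (Nat.lt_floor_add_one _).trans_le (by exact_mod_cast Nat.succ_le_succ hm)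
    have h2 : sampleBound n d ε δ * ε = 16 * (n * d * L ^ 2 + R) := by
      rw [sampleBound, mul_assoc, div_mul_cancel₀ _ hε0.ne']
    have h3 := mul_lt_mul_of_pos_right h1 hε0
    nlinarith
  have hmd : (d : ℝ) ≤ m := by nlinarith
  have hmd' : d ≤ m := by exact_mod_cast hmd
  have hm0 : (0 : ℝ) < m := by linarith
  -- Apply `log y ≤ y` to `y = m * ε / (4 * d)`, so that only a quarter of `ε * m` is spent on `log
  -- m`.
  have hlogm : d * Real.log m ≤ ε * m / 4 + 3 * (d * L) := by
    have h1 : Real.log (m * (ε / (4 * d))) ≤ m * (ε / (4 * d)) :=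
      Real.log_le_self (by positivity)
    have h2 : Real.log m = Real.log (m * (ε / (4 * d))) + Real.log (2 * 2 * (d / ε)) := by
      rw [← Real.log_mul (by positivity) (by positivity)]
      congr 1
      field_simp
      norm_num
    have h3 : Real.log (d / ε) ≤ L := hmono _ (by positivity) (by
      rw [div_mul_cancel₀ _ hε0.ne']
      nlinarith)
    have h4 : Real.log (2 * 2 * (d / ε)) ≤ 3 * L := by
      rw [Real.log_mul (by norm_num) (by positivity), Real.log_mul (by norm_num) (by norm_num)]
      linarith
    have h5 : d * (m * (ε / (4 * d))) = ε * m / 4 := by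
      field_simp
    nlinarith
  have hlogc : d * Real.log (m * n ^ 2 + d) ≤ ε * m / 4 + 6 * (d * L) := by
    have h1 : m * (n : ℝ) ^ 2 + d ≤ 2 * (m * (n * (n * d))) := by
      have h2 : m * (n : ℝ) ^ 2 ≤ m * n ^ 2 * d := le_mul_of_one_le_right (by positivity) hd'
      have h3 : (d : ℝ) ≤ m * n ^ 2 * d := le_mul_of_one_le_left (by positivity) (by nlinarith)
      nlinarith
    have h2 := Real.log_le_log (by positivity) h1
    have h3 : Real.log n ≤ L := hmono _ (by positivity) (by nlinarith)
    have h4 : Real.log (n * d) ≤ L := hmono _ (by positivity) (by nlinarith)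
    rw [Real.log_mul (by norm_num) (by positivity), Real.log_mul (by positivity) (by positivity),
      Real.log_mul (by positivity) (by positivity)] at h2
    have h5 : Real.log (m * n ^ 2 + d) ≤ Real.log m + 3 * L := by linarith
    nlinarith
  have hpos : (0 : ℝ) < m * n ^ 2 + d := by positivity
  have hpow : (1 - ε) ^ (m - d) ≤ Real.exp (-(ε * (m - d))) := by
    have h1 : (1 - ε) ^ (m - d) ≤ Real.exp (-ε) ^ (m - d) :=
      pow_le_pow_left₀ (by linarith) (by linarith [Real.add_one_le_exp (-ε)]) _
    refine h1.trans_eq ?_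
    rw [← Real.exp_nat_mul, Nat.cast_sub hmd']
    congr 1
    ring
  calc ((m : ℝ) * n ^ 2 + d) ^ d * (1 - ε) ^ (m - d)
      ≤ Real.exp (d * Real.log (m * n ^ 2 + d)) * Real.exp (-(ε * (m - d))) := by
        rw [Real.exp_nat_mul, Real.exp_log hpos]
        gcongr
    _ = Real.exp (d * Real.log (m * n ^ 2 + d) + -(ε * (m - d))) := (Real.exp_add _ _).symm
    -- With `ε * d ≤ 2 * (d * L)` it remains that `8 * (d * L) + R ≤ (3/4) * (ε * m)`, which `hεm`
    -- gives.
    _ ≤ Real.exp (-R) := by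
        apply Real.exp_le_exp.2
        nlinarith
    _ = δ := by
        rw [hR, one_div, Real.log_inv, neg_neg, Real.exp_log hδ0]

/-! ### The PAC guarantee and the step polynomial -/

namespace GraphFamily

variable {V : Type u} [Finite V] {X : Type v} [MeasurableSpace X] {d : ℕ}

theorem isPACLearner_tree (F : GraphFamily V X d) :
    IsPACLearner F.hypothesisClass (F.learner F.tree)
      fun ε δ => ⌊sampleBound F.Emax.ncard d ε δ⌋₊ := by
  refine ⟨fun m S => ⟨_, rfl⟩, ?_⟩
  rintro ε hε δ hδ D _ f ⟨_, ⟨w₀, rfl⟩, hf⟩ m hm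
  have herr : ∀ g : X → V × V, trueError D f g = trueError D (F.h w₀) g := fun g => by
    refine measure_congr ?_
    filter_upwards [hf] with x hx
    exact propext (by change g x ≠ f x ↔ g x ≠ F.h w₀ x; rw [hx])
  -- Almost surely `f` and `F.h w₀` label the whole sample alike, so the two failure events differ
  -- by a null set and `f` may be replaced by `F.h w₀`.
  have hlab : ∀ᵐ x ∂Measure.pi (fun _ : Fin m => D), labelled f x = labelled (F.h w₀) x := by
    have : ∀ᵐ x ∂Measure.pi (fun _ : Fin m => D), ∀ i, F.h w₀ (x i) = f (x i) :=
      ae_all_iff.2 fun i =>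
        (measurePreserving_eval (fun _ : Fin m => D) i).quasiMeasurePreserving.ae hf
    filter_upwards [this] with x hx
    funext i
    simp [labelled, hx i]
  have hset : Measure.pi (fun _ : Fin m => D)
        {x | ENNReal.ofReal ε < trueError D f (F.learner F.tree m (labelled f x))} =
      Measure.pi (fun _ : Fin m => D) {x | ENNReal.ofReal ε <
        trueError D (F.h w₀) (F.learner F.tree m (labelled (F.h w₀) x))} := by
    refine measure_congr ?_
    filter_upwards [hlab] with x hx
    refine propext ?_
    change ENNReal.ofReal ε < trueError D f (F.learner F.tree m (labelled f x)) ↔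
      ENNReal.ofReal ε < trueError D (F.h w₀) (F.learner F.tree m (labelled (F.h w₀) x))
    rw [herr, hx]
  rw [hset]
  by_cases hnd : 2 ≤ F.Emax.ncard ∧ 1 ≤ d
  · exact (F.pi_error_le D w₀ hε m).trans
      (ENNReal.ofReal_le_ofReal (candidates_mul_pow_le hnd.1 hnd.2 hε hδ hm))
  -- With at most one edge or no metric the class has a single hypothesis, so the error is zero for
  -- every sample size.
  · have hall : ∀ w, F.h w = F.h w₀ := by
      intro w
      by_cases hd : 1 ≤ d
      · have hn : F.Emax.ncard ≤ 1 := by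
          by_contra h
          exact hnd ⟨by omega, hd⟩
        funext x
        exact (Set.ncard_le_one (Set.toFinite _)).1 hn _ (F.h_mem_Emax w x) _ (F.h_mem_Emax w₀ x)
      · obtain rfl : d = 0 := by omega
        rw [Subsingleton.elim w w₀]
    simp [learner, hall, trueError]

end GraphFamily

/-- The polynomial that bounds the number of steps of the learner with `d` metrics. -/
def stepPolynomial (d : ℕ) : MvPolynomial (Fin 3) ℝ :=
  let N : MvPolynomial (Fin 3) ℝ := .X 0
  let m : MvPolynomial (Fin 3) ℝ :=
    16 * ((N * d * (N * d * .X 1) ^ 2 + .X 2) * .X 1)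
  (m * N ^ 2 + d) ^ d * (m * N ^ 2 * (d * (GraphFamily.weightSteps d + 5) + 8) +
    (1 + d * GraphFamily.weightSteps d)) + (1 + d)

end EdgePAC

end

theorem theorem1 :
    ∃ C : ℝ, 0 < C ∧ ∀ d : ℕ, ∃ p : MvPolynomial (Fin 3) ℝ,
      ∀ (V : Type u) [Finite V] (X : Type v) [MeasurableSpace X] (F : EdgePAC.GraphFamily V X d),
        ∃ (T : ∀ m : ℕ, EdgePAC.CompTree (F.InputIndex m) d) (mH : ℝ → ℝ → ℕ),
          EdgePAC.IsPACLearner F.hypothesisClass (F.learner T) mH ∧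
          ∀ ε ∈ Set.Ioo (0 : ℝ) 1, ∀ δ ∈ Set.Ioo (0 : ℝ) 1,
            (mH ε δ : ℝ) ≤
              C * (((F.Emax.ncard : ℝ) * d * Real.log ((F.Emax.ncard : ℝ) * d / ε) ^ 2
                + Real.log (1 / δ)) / ε) ∧
            ∀ S : Fin (mH ε δ) → X × (V × V),
              (((T (mH ε δ)).steps (F.encode S) : ℕ) : ℝ) ≤
                MvPolynomial.eval ![(F.Emax.ncard : ℝ), 1 / ε, 1 / δ] p := by
  refine ⟨16, by norm_num, fun d => ⟨EdgePAC.stepPolynomial d, ?_⟩⟩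
  intro V _ X _ F
  refine ⟨F.tree, fun ε δ => ⌊EdgePAC.sampleBound F.Emax.ncard d ε δ⌋₊, F.isPACLearner_tree, ?_⟩
  intro ε hε δ hδ
  have hfloor := Nat.floor_le (EdgePAC.sampleBound_nonneg F.Emax.ncard d hε hδ)
  refine ⟨hfloor, fun S => ?_⟩
  have hm := hfloor.trans (EdgePAC.sampleBound_le F.Emax.ncard d hε hδ)
  have hsteps := F.steps_tree_le (F.encode S)
  refine (Nat.cast_le (α := ℝ).2 hsteps).trans ?_
  simp only [EdgePAC.stepPolynomial, map_add, map_mul, map_pow, MvPolynomial.eval_X, map_natCast,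
    map_ofNat, map_one, Matrix.cons_val_zero, Matrix.cons_val_one, Matrix.cons_val]
  have hε0 := hε.1
  have hδ0 := hδ.1
  push_cast
  -- The step bound is increasing in `m`, so `hm` may be substituted for the sample size.
  gcongr
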